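/- For a function $\Psi:\mathbb R\to\mathbb R$ put $\Phi(r)=\tfrac12 r^2-\Psi(r)$, and write $\triangle_1F(x)=F(x+1)-2F(x)+F(x-1)$. Let $\Psi_0(r)=|r|$, with $\Psi_0'=\mathrm{sgn}$, and let $(\Psi_\delta)_{\delta>0}$ be a family of $C^2$ functions with $\Psi_\delta(0)=0$ such that, for some constant $C_\Psi$ and all $\delta>0$, $\Psi_\delta'=\mathrm{sgn}$ outside $(-\delta,\delta)$, $|\Psi_\delta'|\le C_\Psi$ and $|\Psi_\delta''|\le C_\Psi/\delta$. Let $I_\delta=\tfrac12\int_{\mathbb R}(\Psi_\delta'(r)-\mathrm{sgn}(r))\,dr$. For $\delta\ge0$, a travelling wave of speed $c$ is a solution $R\in W^{2,\infty}(\mathbb R)$ of $c^2R''=\triangle_1(R-\Psi_\delta'(R))$. Fix $0<c_0<c_1<1$, positive constants $x_0,r_0,d_0,D_0$, and a constant $C$. For $c_0<c<c_1$ let $R_0$ be a travelling wave of speed $c$ for $\delta=0$ which has the form $R_0(x)=\bar R_0(x)+\alpha(\cos(k_cx)-1)+\beta\sin(k_cx)$ with $\alpha,\beta\in\mathbb R$,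 where $k_c>0$ satisfies $\sin(k_c/2)/(k_c/2)=c$ and where $\bar R_0$ is a travelling wave of speed $c$ for $\delta=0$ such that $\bar R_0(0)=0$, $\bar R_0(x)$ converges as $x\to+\infty$, and $\bar R_0(x)-\alpha^-(\cos(k_cx)-1)-\beta^-\sin(k_cx)$ converges as $x\to-\infty$ for some constants $\alpha^-,\beta^-$. Assume that $\|R_0\|_\infty\le D_0(1-c^2)^{-1}$, that $R_0(x)>r_0$ for $x>x_0$ and $R_0(x)<-r_0$ for $x<-x_0$, and that $R_0'(x)>d_0$ for $|x|<x_0$. For $\delta>0$ let $R_\delta$ be a travelling wave of the same speed $c$ for $\Psi_\delta$ of the form $R_\delta=R_0-I_\delta+S$, where $S\in W^{2,\infty}(\mathbb R)$ satisfies $S(0)=0$, $S(x)$ converges as $x\to+\infty$, $S(x)-a_-R_0(x+d_-)$ converges as $x\to-\infty$ for some constants $a_-,d_-$, and $$\|S\|_\infty\le C\delta^2,\qquad \|S'\|_\infty\le C\delta,\qquad \|S''\|_\infty\le C .$$ For $\delta\ge0$ define the macroscopic strains on the two sides of the interface and the configurational force by $$\bar r_{\delta,\pm}=\lim_{L\to\infty}\frac1L\int_0^LR_\delta(\pm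 x)\,dx,\qquad \Upsilon_\delta=\Upsilon_{\mathrm e,\delta}-\Upsilon_{\mathrm f,\delta},$$ $$\Upsilon_{\mathrm e,\delta}=\Phi_\delta(\bar r_{\delta,+})-\Phi_\delta(\bar r_{\delta,-}),\qquad \Upsilon_{\mathrm f,\delta}=\frac{\Phi_\delta'(\bar r_{\delta,+})+\Phi_\delta'(\bar r_{\delta,-})}2\,(\bar r_{\delta,+}-\bar r_{\delta,-}).$$ Then $\Upsilon_\delta=\Upsilon_0+O(\delta^2)$. More precisely, there are constants $K$ and $\delta_0>0$, depending only on $c_0,c_1,x_0,r_0,d_0,D_0,C_\Psi$ and $C$, such that for every such family $(\Psi_\delta)_{\delta>0}$, all $0<\delta<\delta_0$, all $c\in(c_0,c_1)$ and all such waves $R_0$ and $R_\delta$, the four limits $\bar r_{0,\pm}$ and $\bar r_{\delta,\pm}$ exist and $|\Upsilon_\delta-\Upsilon_0|\le K\delta^2$. -/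

import Mathlib

open MeasureTheory Filter Topology
open scoped ContDiff

namespace PhaseWave

/-- `g` is the weak derivative of `f` on the real line (tested against `C_c^∞`). -/
def HasWeakDeriv (f g : ℝ → ℝ) : Prop :=
  ∀ φ : ℝ → ℝ, ContDiff ℝ ∞ φ → HasCompactSupport φ →
    ∫ x, f x * deriv φ x = -∫ x, g x * φ x

/-- `R` is (the continuous representative of) an element of the Sobolev space `W^{2,∞}(ℝ)`,
with first and second weak derivatives `R₁` and `R₂`. -/
structure IsW2Infty (R R₁ R₂ : ℝ → ℝ) : Prop where
  continuous : Continuous R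
  memLp : MemLp R ⊤ volume
  memLp₁ : MemLp R₁ ⊤ volume
  memLp₂ : MemLp R₂ ⊤ volume
  weakDeriv₁ : HasWeakDeriv R R₁
  weakDeriv₂ : HasWeakDeriv R₁ R₂

/-- The discrete Laplacian `Δ₁ F (x) = F (x+1) - 2 F x + F (x-1)`. -/
def discreteLaplacian (F : ℝ → ℝ) (x : ℝ) : ℝ := F (x + 1) - 2 * F x + F (x - 1)

/-- The interaction potential `Φ(r) = r² / 2 - Ψ(r)` belonging to `Ψ`. -/
noncomputable def interactionPotential (Ψ : ℝ → ℝ) (r : ℝ) : ℝ := r ^ 2 / 2 - Ψ r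

/-- The unperturbed `Ψ₀(r) = |r|`, so that `Ψ₀' = sgn` and `Ψ₀(0) = 0`. -/
def unperturbed (r : ℝ) : ℝ := |r|

/-- `Ψ₀' = sgn`; at the origin both sides are `0`. -/
theorem deriv_unperturbed (r : ℝ) : deriv unperturbed r = Real.sign r := by
  have h : unperturbed = fun x : ℝ => |x| := rfl
  rw [h, deriv_abs]
  rcases lt_trichotomy r 0 with hr | hr | hr
  · simp [hr, Real.sign_of_neg]
  · simp [hr]
  · simp [hr, Real.sign_of_pos]

/-- The assumptions on the family `(Ψ_δ)_{δ > 0}` with constant `CΨ`: each `Ψ_δ` is `C²` with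
`Ψ_δ(0) = 0`, `Ψ_δ'` agrees with `sgn` outside `(-δ, δ)`, `|Ψ_δ'| ≤ CΨ`, `|Ψ_δ''| ≤ CΨ / δ`. -/
structure IsAdmissibleFamily (CΨ : ℝ) (Ψ : ℝ → ℝ → ℝ) : Prop where
  contDiff : ∀ δ, 0 < δ → ContDiff ℝ 2 (Ψ δ)
  zero : ∀ δ, 0 < δ → Ψ δ 0 = 0
  eq_sign : ∀ δ, 0 < δ → ∀ r, r ∉ Set.Ioo (-δ) δ → deriv (Ψ δ) r = Real.sign r
  deriv_le : ∀ δ, 0 < δ → ∀ r, |deriv (Ψ δ) r| ≤ CΨ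
  deriv2_le : ∀ δ, 0 < δ → ∀ r, |deriv (deriv (Ψ δ)) r| ≤ CΨ / δ

/-- `I = ½ ∫ (Ψ' - sgn)`. -/
noncomputable def meanShift (Ψ : ℝ → ℝ) : ℝ := (1 / 2) * ∫ r, (deriv Ψ r - Real.sign r)

/-- `R ∈ W^{2,∞}(ℝ)` solves `c² R'' = Δ₁ (R - Ψ'(R))`, as an identity in `L^∞(ℝ)`. -/
def IsTravellingWave (Ψ : ℝ → ℝ) (c : ℝ) (R : ℝ → ℝ) : Prop :=
  ∃ R₁ R₂ : ℝ → ℝ, IsW2Infty R R₁ R₂ ∧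
    ∀ᵐ x, c ^ 2 * R₂ x = discreteLaplacian (fun y => R y - deriv Ψ (R y)) x

/-- `k` is a wave number `k_c > 0`, that is a root of `sin(k/2) / (k/2) = c`. -/
def IsWaveNumber (c k : ℝ) : Prop := 0 < k ∧ Real.sin (k / 2) / (k / 2) = c

/-- The wave for the unperturbed potential that is normalised at `0`, asymptotically constant
ahead of the interface, and harmonic with wave number `k` behind it. -/
def IsNonoscillatoryFront (c k : ℝ) (R : ℝ → ℝ) : Prop :=
  IsTravellingWave unperturbed c R ∧ R 0 = 0 ∧
    ∃ rplus rminus a b : ℝ,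
      Tendsto R atTop (𝓝 rplus) ∧
      Tendsto (fun x => R x - a * (Real.cos (k * x) - 1) - b * Real.sin (k * x))
        atBot (𝓝 rminus)

/-- The waves `R₀` of speed `c` for the unperturbed potential: `R₀` arises from a front by adding
`α (cos(k_c x) - 1) + β sin(k_c x)`, and satisfies the bounds with constants `x₀, r₀, d₀, D₀`.
As `R₀ ∈ W^{2,∞}(ℝ)` is continuously differentiable, `deriv R₀` is its classical derivative. -/
structure IsUnperturbedWave (x₀ r₀ d₀ D₀ c : ℝ) (R₀ : ℝ → ℝ) : Prop where
  wave : IsTravellingWave unperturbed c R₀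
  family : ∃ k, IsWaveNumber c k ∧ ∃ Rbar, IsNonoscillatoryFront c k Rbar ∧
    ∃ α β : ℝ, ∀ x, R₀ x = Rbar x + α * (Real.cos (k * x) - 1) + β * Real.sin (k * x)
  norm_le : eLpNorm R₀ ⊤ volume ≤ ENNReal.ofReal (D₀ * (1 - c ^ 2)⁻¹)
  ahead : ∀ x, x₀ < x → r₀ < R₀ x
  behind : ∀ x, x < -x₀ → R₀ x < -r₀
  steep : ∀ x, |x| < x₀ → d₀ < deriv R₀ x

/-- The waves `R = R₀ - I_δ + S` for the perturbed potential `Ψ = Ψ_δ`: the corrector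
`S ∈ W^{2,∞}(ℝ)` vanishes at `0`, converges at `+∞`, has a harmonic tail at `-∞`, and satisfies
`‖S‖ ≤ C δ²`, `‖S'‖ ≤ C δ` and `‖S''‖ ≤ C` in `L^∞(ℝ)`. -/
structure IsPerturbedWave (Ψ : ℝ → ℝ) (C δ c : ℝ) (R₀ R : ℝ → ℝ) : Prop where
  wave : IsTravellingWave Ψ c R
  corrector : ∃ S S₁ S₂ : ℝ → ℝ, IsW2Infty S S₁ S₂ ∧
    (∀ x, R x = R₀ x - meanShift Ψ + S x) ∧
    S 0 = 0 ∧
    (∃ σ, Tendsto S atTop (𝓝 σ)) ∧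
    (∃ a d τ : ℝ, Tendsto (fun x => S x - a * R₀ (x + d)) atBot (𝓝 τ)) ∧
    eLpNorm S ⊤ volume ≤ ENNReal.ofReal (C * δ ^ 2) ∧
    eLpNorm S₁ ⊤ volume ≤ ENNReal.ofReal (C * δ) ∧
    eLpNorm S₂ ⊤ volume ≤ ENNReal.ofReal C

/-- The macroscopic strains of `R` exist: ahead of the interface `rp = lim (1/L) ∫₀^L R(x) dx`,
and behind it `rm = lim (1/L) ∫₀^L R(-x) dx`. -/
def HasMacroscopicStrains (R : ℝ → ℝ) (rp rm : ℝ) : Prop :=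
  Tendsto (fun L : ℝ => (1 / L) * ∫ x in (0 : ℝ)..L, R x) atTop (𝓝 rp) ∧
  Tendsto (fun L : ℝ => (1 / L) * ∫ x in (0 : ℝ)..L, R (-x)) atTop (𝓝 rm)

/-- `Υ_e = Φ(rp) - Φ(rm)`. -/
noncomputable def energyJump (Ψ : ℝ → ℝ) (rp rm : ℝ) : ℝ :=
  interactionPotential Ψ rp - interactionPotential Ψ rm

/-- `Υ_f = (Φ'(rp) + Φ'(rm)) / 2 * (rp - rm)`. -/
noncomputable def meanForceWork (Ψ : ℝ → ℝ) (rp rm : ℝ) : ℝ :=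
  (deriv (interactionPotential Ψ) rp + deriv (interactionPotential Ψ) rm) / 2 * (rp - rm)

/-- The configurational force `Υ = Υ_e - Υ_f`. -/
noncomputable def configurationalForce (Ψ : ℝ → ℝ) (rp rm : ℝ) : ℝ :=
  energyJump Ψ rp rm - meanForceWork Ψ rp rm

end PhaseWave

/-! ### Mean values over half-lines. -/

namespace PhaseWave

/-! When the strains lie in the two linear wells, the quadratic parts of the energy jump and of the
mean force work cancel, so the force is linear in the strains: `-(rp + rm)` for `Ψ₀`, and `-(rp +
rm) - 2 I_δ` for `Ψ_δ`, since `Ψ_δ - |·|` jumps by `2 I_δ` across the layer (`two_mul_meanShift`).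
Averaging `R_δ = R₀ - I_δ + S` shifts both strains by `-I_δ`, up to the means `sp`, `sm` of `S`,
which are at most `|C| δ²`. The two contributions of `I_δ` cancel, leaving `Υ_δ - Υ₀ = -(sp + sm)`.
The means exist because every tail is asymptotically a constant plus a harmonic of zero mean. -/

/-- `m` is the mean value of `f` over `[0, ∞)`. -/
def HasMean (f : ℝ → ℝ) (m : ℝ) : Prop :=
  Tendsto (fun L : ℝ => (1 / L) * ∫ x in (0 : ℝ)..L, f x) atTop (𝓝 m)

theorem HasMean.add {f g : ℝ → ℝ} {m n : ℝ} (hf : HasMean f m) (hg : HasMean g n)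
    (hfc : Continuous f) (hgc : Continuous g) : HasMean (fun x => f x + g x) (m + n) := by
  refine (Tendsto.add hf hg).congr fun L => ?_
  rw [intervalIntegral.integral_add (hfc.intervalIntegrable _ _) (hgc.intervalIntegrable _ _)]
  ring

theorem HasMean.const_mul {f : ℝ → ℝ} {m : ℝ} (hf : HasMean f m) (a : ℝ) :
    HasMean (fun x => a * f x) (a * m) := by
  refine (Tendsto.const_mul a hf).congr fun L => ?_
  rw [intervalIntegral.integral_const_mul]
  ring

theorem hasMean_const (a : ℝ) : HasMean (fun _ => a) a := by
  refine tendsto_const_nhds.congr' ?_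
  filter_upwards [eventually_gt_atTop 0] with L hL
  rw [intervalIntegral.integral_const, smul_eq_mul]
  field_simp
  ring

/-- A function with bounded primitive has mean value zero. -/
theorem hasMean_zero_of_bounded_primitive {f : ℝ → ℝ} {B : ℝ}
    (h : ∀ L, |∫ x in (0 : ℝ)..L, f x| ≤ B) : HasMean f 0 := by
  have hB : Tendsto (fun L : ℝ => B / L) atTop (𝓝 0) := tendsto_const_nhds.div_atTop tendsto_id
  refine squeeze_zero_norm' ?_ hB
  filter_upwards [eventually_gt_atTop 0] with L hL
  rw [Real.norm_eq_abs, abs_mul, abs_of_pos (by positivity : 0 < 1 / L), one_div, inv_mul_eq_div]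
  exact div_le_div_of_nonneg_right (h L) hL.le

/-- Cesàro argument: the integral over the head `[0, N]` is fixed, and on the tail the integrand is
below `ε / 2`. -/
theorem hasMean_of_tendsto_zero {f : ℝ → ℝ} (hc : Continuous f)
    (hf : Tendsto f atTop (𝓝 0)) : HasMean f 0 := by
  refine Metric.tendsto_atTop.2 fun ε hε => ?_
  obtain ⟨M, hM⟩ := Metric.tendsto_atTop.1 hf (ε / 2) (half_pos hε)
  set N := max M 0
  set A := |∫ x in (0 : ℝ)..N, f x|
  have hN : 0 ≤ N := le_max_right _ _
  -- Beyond `2 * A / ε` the head contributes less than `ε / 2` to the average.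
  refine ⟨max N (2 * A / ε) + 1, fun L hL => ?_⟩
  have hLN : N + 1 ≤ L := le_trans (by gcongr; exact le_max_left _ _) hL
  have hLA : 2 * A / ε < L :=
    lt_of_lt_of_le (by linarith [le_max_right N (2 * A / ε)]) hL
  have hL0 : 0 < L := by linarith
  have hsplit := intervalIntegral.integral_add_adjacent_intervals
    (hc.intervalIntegrable (μ := volume) 0 N) (hc.intervalIntegrable N L)
  have htail : |∫ x in N..L, f x| ≤ ε / 2 * (L - N) := by
    have := intervalIntegral.norm_integral_le_of_norm_le_const (a := N) (b := L) (f := f)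
      (C := ε / 2) fun x hx => by
        rw [Set.uIoc_of_le (by linarith)] at hx
        have := hM x ((le_max_left M 0).trans hx.1.le)
        rw [dist_zero_right] at this
        exact this.le
    rwa [abs_of_nonneg (by linarith), Real.norm_eq_abs] at this
  rw [dist_zero_right, Real.norm_eq_abs, abs_mul, abs_of_pos (by positivity : 0 < 1 / L),
    one_div, inv_mul_eq_div, div_lt_iff₀ hL0, ← hsplit]
  rw [div_lt_iff₀ hε] at hLA
  have := abs_add_le (∫ x in (0 : ℝ)..N, f x) (∫ x in N..L, f x)
  have : 0 ≤ ε * N := by positivity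
  change _ ≤ A + _ at *
  nlinarith

theorem hasMean_cos {k : ℝ} (hk : 0 < k) : HasMean (fun x => Real.cos (k * x)) 0 := by
  refine hasMean_zero_of_bounded_primitive (B := k⁻¹) fun L => ?_
  rw [intervalIntegral.integral_comp_mul_left _ hk.ne', integral_cos, smul_eq_mul, abs_mul,
    abs_of_pos (inv_pos.2 hk)]
  simpa using mul_le_mul_of_nonneg_left (Real.abs_sin_le_one (k * L)) (inv_pos.2 hk).le

theorem hasMean_sin {k : ℝ} (hk : 0 < k) : HasMean (fun x => Real.sin (k * x)) 0 := by
  refine hasMean_zero_of_bounded_primitive (B := k⁻¹ * 2) fun L => ?_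
  rw [intervalIntegral.integral_comp_mul_left _ hk.ne', integral_sin, smul_eq_mul, abs_mul,
    abs_of_pos (inv_pos.2 hk)]
  refine mul_le_mul_of_nonneg_left ?_ (inv_pos.2 hk).le
  rw [mul_zero, Real.cos_zero, abs_le]
  constructor <;> linarith [Real.neg_one_le_cos (k * L), Real.cos_le_one (k * L)]

/-- A function that approaches a harmonic oscillation about `l` has mean value `l`. -/
theorem hasMean_of_harmonic_tail {f : ℝ → ℝ} {k a b l : ℝ} (hk : 0 < k) (hc : Continuous f)
    (hf : Tendsto (fun x => f x - a * Real.cos (k * x) - b * Real.sin (k * x)) atTop (𝓝 l)) :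
    HasMean f l := by
  have h0 : HasMean (fun x => f x - a * Real.cos (k * x) - b * Real.sin (k * x) - l) 0 :=
    hasMean_of_tendsto_zero (by fun_prop) (by simpa using hf.sub_const l)
  have h := ((h0.add ((hasMean_cos hk).const_mul a) (by fun_prop) (by fun_prop)).add
    ((hasMean_sin hk).const_mul b) (by fun_prop) (by fun_prop)).add (hasMean_const l)
    (by fun_prop) (by fun_prop)
  convert h using 1
  · funext x
    ring
  · ring

/-- The same for a harmonic oscillation behind the interface. -/
theorem hasMean_neg_of_harmonic_tail {f : ℝ → ℝ} {k a b l : ℝ} (hk : 0 < k) (hc : Continuous f)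
    (hf : Tendsto (fun x => f x - a * Real.cos (k * x) - b * Real.sin (k * x)) atBot (𝓝 l)) :
    HasMean (fun x => f (-x)) l := by
  refine hasMean_of_harmonic_tail (a := a) (b := -b) hk (by fun_prop)
    ((hf.comp tendsto_neg_atTop_atBot).congr fun x => ?_)
  simp only [Function.comp_apply, mul_neg, Real.cos_neg, Real.sin_neg]
  ring

theorem HasMean.abs_le {f : ℝ → ℝ} {m B : ℝ} (hf : HasMean f m) (h : ∀ x, |f x| ≤ B) :
    |m| ≤ B := by
  refine le_of_tendsto hf.abs ?_
  filter_upwards [eventually_gt_atTop 0] with L hL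
  have := intervalIntegral.norm_integral_le_of_norm_le_const (a := 0) (b := L) (f := f) (C := B)
    fun x _ => h x
  rw [sub_zero, abs_of_pos hL, Real.norm_eq_abs] at this
  rwa [abs_mul, abs_of_pos (by positivity : 0 < 1 / L), one_div, inv_mul_eq_div, div_le_iff₀ hL]

theorem HasMean.ge_of_eventually_ge {f : ℝ → ℝ} {m r : ℝ} (hf : HasMean f m) (hc : Continuous f)
    (h : ∀ᶠ x in atTop, r ≤ f x) : r ≤ m := by
  -- This correction vanishes eventually, so it does not alter the mean; adding it lifts `f` to at
  -- least `r` everywhere.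
  have h0 : HasMean (fun x => max (r - f x) 0) 0 := by
    refine hasMean_of_tendsto_zero (by fun_prop) (tendsto_const_nhds.congr' ?_)
    filter_upwards [h] with x hx
    rw [max_eq_right (by linarith)]
  have hsum := hf.add h0 hc (by fun_prop)
  rw [add_zero] at hsum
  refine ge_of_tendsto hsum ?_
  filter_upwards [eventually_gt_atTop 0] with L hL
  have hmono : ∫ _ in (0 : ℝ)..L, r ≤ ∫ x in (0 : ℝ)..L, (f x + max (r - f x) 0) :=
    intervalIntegral.integral_mono_on hL.le (by simp)
      (Continuous.intervalIntegrable (by fun_prop) _ _)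
      fun x _ => by linarith [le_max_left (r - f x) 0]
  rw [intervalIntegral.integral_const, smul_eq_mul, sub_zero] at hmono
  rw [one_div, inv_mul_eq_div, le_div_iff₀ hL]
  linarith

/-- A continuous function is bounded everywhere by any bound of its `L^∞` norm. -/
theorem abs_le_of_eLpNorm_top_le {f : ℝ → ℝ} {B : ℝ} (hc : Continuous f) (hB : 0 ≤ B)
    (h : eLpNorm f ⊤ volume ≤ ENNReal.ofReal B) (x : ℝ) : |f x| ≤ B := by
  have hae : ∀ᵐ y, |f y| ≤ B := by
    filter_upwards [ae_le_eLpNormEssSup (f := f) (μ := volume)] with y hy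
    rw [eLpNorm_exponent_top] at h
    have h' := hy.trans h
    rw [← ofReal_norm, Real.norm_eq_abs] at h'
    exact (ENNReal.ofReal_le_ofReal_iff hB).1 h'
  -- A closed set of full measure is dense, hence everything.
  have hcl : IsClosed {y | |f y| ≤ B} := isClosed_le (by fun_prop) continuous_const
  have huniv : closure {y | |f y| ≤ B} = Set.univ := (Measure.dense_of_ae hae).closure_eq
  rw [hcl.closure_eq] at huniv
  exact Set.eq_univ_iff_forall.1 huniv x

/-! ### The potential and the configurational force in the wells. -/

section Potential

variable {CΨ δ : ℝ} {Ψ : ℝ → ℝ → ℝ}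

/-- The jump of `Ψ_δ - |·|` across the transition layer is `2 I_δ`. -/
theorem IsAdmissibleFamily.two_mul_meanShift (h : IsAdmissibleFamily CΨ Ψ) (hδ : 0 < δ)
    {a b : ℝ} (ha : a ≤ -δ) (hb : δ ≤ b) :
    2 * meanShift (Ψ δ) = Ψ δ b - Ψ δ a - (b + a) := by
  have hdiff : Differentiable ℝ (Ψ δ) := (h.contDiff δ hδ).differentiable (by norm_num)
  have hmeas : Measurable fun r => deriv (Ψ δ) r - Real.sign r := by
    simp_rw [← deriv_unperturbed]
    exact (measurable_deriv _).sub (measurable_deriv _)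
  have hbound : ∀ r, ‖deriv (Ψ δ) r - Real.sign r‖ ≤ CΨ + 1 := fun r => by
    refine (norm_sub_le _ _).trans (add_le_add (h.deriv_le δ hδ r) ?_)
    rcases Real.sign_apply_eq r with hr | hr | hr <;> simp [hr]
  have hab : a ≤ b := by linarith
  have hint : IntervalIntegrable (fun r => deriv (Ψ δ) r - Real.sign r) volume a b :=
    (intervalIntegrable_const (c := CΨ + 1)).mono_fun hmeas.aestronglyMeasurable
      (Eventually.of_forall fun r => (hbound r).trans (le_abs_self _))
  -- The kink of `|r|` at `0` is the one point excluded from differentiability.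
  have hftc := integral_eq_of_hasDerivAt_off_countable (fun r => Ψ δ r - |r|)
    (fun r => deriv (Ψ δ) r - Real.sign r) (Set.countable_singleton (0 : ℝ))
    (a := a) (b := b) (hdiff.continuous.sub continuous_abs).continuousOn
    (fun r hr => by
      refine (hdiff r).hasDerivAt.sub ?_
      have := (hasDerivAt_abs (x := r) (by simpa using hr.2))
      rwa [← this.deriv, ← show unperturbed = fun r : ℝ => |r| from rfl,
        deriv_unperturbed] at this) hint
  have hsupp : ∫ r, (deriv (Ψ δ) r - Real.sign r) =
      ∫ r in a..b, (deriv (Ψ δ) r - Real.sign r) := by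
    rw [intervalIntegral.integral_of_le hab]
    refine (setIntegral_eq_integral_of_forall_compl_eq_zero fun r hr => ?_).symm
    refine sub_eq_zero.2 (h.eq_sign δ hδ r fun hr' => hr ⟨?_, ?_⟩)
    · linarith [hr'.1]
    · linarith [hr'.2]
  rw [meanShift, hsupp, hftc, abs_of_nonneg (by linarith : 0 ≤ b),
    abs_of_nonpos (by linarith : a ≤ 0)]
  ring

/-- On the symmetric interval `[-δ, δ]` the term `b + a` drops out, and the mean value inequality
over length `2δ` gives the bound. -/
theorem IsAdmissibleFamily.abs_meanShift_le (h : IsAdmissibleFamily CΨ Ψ) (hδ : 0 < δ) :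
    |meanShift (Ψ δ)| ≤ CΨ * δ := by
  have hdiff : Differentiable ℝ (Ψ δ) := (h.contDiff δ hδ).differentiable (by norm_num)
  have h1 := h.two_mul_meanShift hδ le_rfl le_rfl
  have h2 := Convex.norm_image_sub_le_of_norm_deriv_le (f := Ψ δ) (C := CΨ) (s := Set.univ)
    (fun r _ => hdiff r) (fun r _ => h.deriv_le δ hδ r) convex_univ
    (Set.mem_univ (-δ)) (Set.mem_univ δ)
  rw [Real.norm_eq_abs, Real.norm_eq_abs, abs_of_pos (by linarith : 0 < δ - -δ)] at h2
  have h3 : meanShift (Ψ δ) = (Ψ δ δ - Ψ δ (-δ)) / 2 := by linarith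
  rw [h3, abs_div, abs_two, div_le_iff₀ two_pos]
  linarith

theorem deriv_interactionPotential {Ψ : ℝ → ℝ} {r : ℝ} (h : DifferentiableAt ℝ Ψ r) :
    deriv (interactionPotential Ψ) r = r - deriv Ψ r := by
  have h2 : HasDerivAt (fun r : ℝ => r ^ 2 / 2) r r := by
    simpa using (hasDerivAt_pow 2 r).div_const 2
  exact (h2.sub h.hasDerivAt).deriv

/-- For strains in the two linear wells, the quadratic contributions cancel. -/
theorem configurationalForce_eq_of_deriv {Ψ : ℝ → ℝ} {rp rm : ℝ}
    (hp : DifferentiableAt ℝ Ψ rp) (hm : DifferentiableAt ℝ Ψ rm)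
    (hp' : deriv Ψ rp = 1) (hm' : deriv Ψ rm = -1) :
    configurationalForce Ψ rp rm = Ψ rm - Ψ rp := by
  rw [configurationalForce, energyJump, meanForceWork, deriv_interactionPotential hp,
    deriv_interactionPotential hm, hp', hm', interactionPotential, interactionPotential]
  ring

theorem configurationalForce_unperturbed {rp rm : ℝ} (hp : 0 < rp) (hm : rm < 0) :
    configurationalForce unperturbed rp rm = -(rp + rm) := by
  rw [configurationalForce_eq_of_deriv (Ψ := unperturbed) (differentiableAt_abs hp.ne')
    (differentiableAt_abs hm.ne)
    (by rw [deriv_unperturbed, Real.sign_of_pos hp])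
    (by rw [deriv_unperturbed, Real.sign_of_neg hm]),
    unperturbed, unperturbed, abs_of_pos hp, abs_of_neg hm]
  ring

theorem IsAdmissibleFamily.configurationalForce_eq (h : IsAdmissibleFamily CΨ Ψ) (hδ : 0 < δ)
    {rp rm : ℝ} (hp : δ ≤ rp) (hm : rm ≤ -δ) :
    configurationalForce (Ψ δ) rp rm = -(rp + rm) - 2 * meanShift (Ψ δ) := by
  have hdiff : Differentiable ℝ (Ψ δ) := (h.contDiff δ hδ).differentiable (by norm_num)
  rw [configurationalForce_eq_of_deriv (hdiff rp) (hdiff rm)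
    (by rw [h.eq_sign δ hδ rp fun hr => hp.not_gt hr.2, Real.sign_of_pos (by linarith)])
    (by rw [h.eq_sign δ hδ rm fun hr => hm.not_gt hr.1, Real.sign_of_neg (by linarith)]),
    h.two_mul_meanShift hδ hm hp]
  ring

end Potential

/-! ### Tails and strains of the waves. -/

section Waves

variable {x₀ r₀ d₀ D₀ c : ℝ} {R₀ : ℝ → ℝ}

theorem IsTravellingWave.continuous {Ψ : ℝ → ℝ} {R : ℝ → ℝ} (h : IsTravellingWave Ψ c R) :
    Continuous R := by
  obtain ⟨_, _, hR, _⟩ := h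
  exact hR.continuous

/-- The added oscillation has the same wave number as the tail of the front, so amplitudes add; the
`-1` in `cos - 1` moves into the limits. -/
theorem IsUnperturbedWave.harmonic_tails (h : IsUnperturbedWave x₀ r₀ d₀ D₀ c R₀) :
    ∃ k, 0 < k ∧
      (∃ a b l, Tendsto (fun x => R₀ x - a * Real.cos (k * x) - b * Real.sin (k * x))
        atTop (𝓝 l)) ∧
      ∃ a b l, Tendsto (fun x => R₀ x - a * Real.cos (k * x) - b * Real.sin (k * x))
        atBot (𝓝 l) := by
  obtain ⟨k, hk, Rbar, ⟨-, -, rplus, rminus, a, b, hplus, hminus⟩, α, β, hR⟩ := h.family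
  refine ⟨k, hk.1, ⟨α, β, rplus - α, (hplus.sub_const α).congr fun x => ?_⟩,
    ⟨a + α, b + β, rminus - a - α, ((hminus.sub_const a).sub_const α).congr fun x => ?_⟩⟩
  · rw [hR]
    ring
  · rw [hR]
    ring

/-- A function which behind the interface is asymptotic to a multiple of a shift of a harmonic
tail has itself a harmonic tail, hence a mean value. -/
theorem exists_hasMean_neg_of_shifted_tail {f S : ℝ → ℝ} {k A B l a d τ : ℝ} (hk : 0 < k)
    (hc : Continuous S)
    (hf : Tendsto (fun x => f x - A * Real.cos (k * x) - B * Real.sin (k * x)) atBot (𝓝 l))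
    (hS : Tendsto (fun x => S x - a * f (x + d)) atBot (𝓝 τ)) :
    ∃ m, HasMean (fun x => S (-x)) m := by
  have hshift := (hf.comp (tendsto_atBot_add_const_right atBot d tendsto_id)).const_mul a
  refine ⟨τ + a * l, hasMean_neg_of_harmonic_tail
    -- Amplitudes of the shifted harmonic, from the addition formulas.
    (a := a * (A * Real.cos (k * d) + B * Real.sin (k * d)))
    (b := a * (B * Real.cos (k * d) - A * Real.sin (k * d))) hk hc
    ((hS.add hshift).congr fun x => ?_)⟩
  simp only [Function.comp_apply, id_eq, mul_add, Real.cos_add, Real.sin_add]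
  ring

theorem IsUnperturbedWave.exists_strains (h : IsUnperturbedWave x₀ r₀ d₀ D₀ c R₀) :
    ∃ rp rm, HasMacroscopicStrains R₀ rp rm ∧ r₀ ≤ rp ∧ rm ≤ -r₀ := by
  obtain ⟨k, hk, ⟨a, b, l, hp⟩, a', b', l', hm⟩ := h.harmonic_tails
  have hc := h.wave.continuous
  have h1 := hasMean_of_harmonic_tail hk hc hp
  have h2 := hasMean_neg_of_harmonic_tail hk hc hm
  refine ⟨l, l', ⟨h1, h2⟩, h1.ge_of_eventually_ge hc ?_, ?_⟩
  · filter_upwards [eventually_gt_atTop x₀] with x hx using (h.ahead x hx).le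
  · have h3 : r₀ ≤ -1 * l' := (h2.const_mul (-1)).ge_of_eventually_ge (by fun_prop) (by
      filter_upwards [eventually_gt_atTop x₀] with x hx
      linarith [h.behind (-x) (by linarith)])
    linarith

/-- The strains of the perturbed wave are those of `R₀`, shifted by `-I_δ` up to `O(δ²)`. -/
theorem IsPerturbedWave.exists_strains {Ψ : ℝ → ℝ} {C δ : ℝ} {R : ℝ → ℝ}
    (h₀ : IsUnperturbedWave x₀ r₀ d₀ D₀ c R₀) (h : IsPerturbedWave Ψ C δ c R₀ R)
    {rp rm : ℝ} (hs : HasMacroscopicStrains R₀ rp rm) :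
    ∃ sp sm, HasMacroscopicStrains R (rp - meanShift Ψ + sp) (rm - meanShift Ψ + sm) ∧
      |sp| ≤ |C| * δ ^ 2 ∧ |sm| ≤ |C| * δ ^ 2 := by
  obtain ⟨S, S₁, S₂, hW, hR, -, ⟨σ, hσ⟩, ⟨a, d, τ, hτ⟩, hS, -, -⟩ := h.corrector
  obtain ⟨k, hk, -, a', b', l', hm⟩ := h₀.harmonic_tails
  have hc₀ := h₀.wave.continuous
  have hSc := hW.continuous
  have hbound : ∀ x, |S x| ≤ |C| * δ ^ 2 := abs_le_of_eLpNorm_top_le hSc (by positivity)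
    (hS.trans (ENNReal.ofReal_le_ofReal
      (mul_le_mul_of_nonneg_right (le_abs_self C) (sq_nonneg δ))))
  have hSp : HasMean S σ :=
    hasMean_of_harmonic_tail (a := 0) (b := 0) hk hSc (by simpa using hσ)
  obtain ⟨sm, hSm⟩ := exists_hasMean_neg_of_shifted_tail hk hSc hm hτ
  have hRp := (HasMean.add hs.1 (hasMean_const (-meanShift Ψ)) hc₀ continuous_const).add hSp
    (by fun_prop) hSc
  have hRm := (HasMean.add hs.2 (hasMean_const (-meanShift Ψ)) (by fun_prop)
    continuous_const).add hSm (by fun_prop) (by fun_prop)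
  simp only [← sub_eq_add_neg, ← hR] at hRp hRm
  exact ⟨σ, sm, ⟨hRp, hRm⟩, hSp.abs_le hbound, hSm.abs_le fun x => hbound (-x)⟩

end Waves

end PhaseWave

/-! ### The estimate with explicit constants. -/

theorem mainTheorem5
    (c₀ c₁ : ℝ) (hc₀ : 0 < c₀) (hc₀₁ : c₀ < c₁) (hc₁ : c₁ < 1)
    (x₀ r₀ d₀ D₀ : ℝ) (hx₀ : 0 < x₀) (hr₀ : 0 < r₀) (hd₀ : 0 < d₀) (hD₀ : 0 < D₀)
    (CΨ C : ℝ) :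
    ∃ K δ₀ : ℝ, 0 < δ₀ ∧
      ∀ Ψ : ℝ → ℝ → ℝ, PhaseWave.IsAdmissibleFamily CΨ Ψ →
      ∀ δ : ℝ, 0 < δ → δ < δ₀ →
      ∀ c : ℝ, c₀ < c → c < c₁ →
      ∀ R₀ : ℝ → ℝ, PhaseWave.IsUnperturbedWave x₀ r₀ d₀ D₀ c R₀ →
      ∀ R : ℝ → ℝ, PhaseWave.IsPerturbedWave (Ψ δ) C δ c R₀ R →
      ∃ rp₀ rm₀ rp rm : ℝ,
        PhaseWave.HasMacroscopicStrains R₀ rp₀ rm₀ ∧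
        PhaseWave.HasMacroscopicStrains R rp rm ∧
        |PhaseWave.configurationalForce (Ψ δ) rp rm
          - PhaseWave.configurationalForce PhaseWave.unperturbed rp₀ rm₀| ≤ K * δ ^ 2 := by
  have hden : 0 < |CΨ| + |C| + 1 := by positivity
  -- `K` bounds `|sp + sm|`. For `δ < 1` both strains move by at most `(|CΨ| + |C|) δ`, and the
  -- extra `1` keeps them at distance `δ` from zero, inside the wells of `Ψ_δ`.
  refine ⟨2 * |C|, min 1 (r₀ / (|CΨ| + |C| + 1)), by positivity, ?_⟩
  intro Ψ hΨ δ hδ hδ₀ c _ _ R₀ hR₀ R hR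
  obtain ⟨rp, rm, hs, hrp, hrm⟩ := hR₀.exists_strains
  obtain ⟨sp, sm, hs', hsp, hsm⟩ := hR.exists_strains hR₀ hs
  refine ⟨rp, rm, _, _, hs, hs', ?_⟩
  have hδ1 : δ < 1 := hδ₀.trans_le (min_le_left _ _)
  have hδr : δ * (|CΨ| + |C| + 1) < r₀ :=
    (lt_div_iff₀ hden).1 (hδ₀.trans_le (min_le_right _ _))
  have hI : |PhaseWave.meanShift (Ψ δ)| ≤ |CΨ| * δ :=
    (hΨ.abs_meanShift_le hδ).trans (mul_le_mul_of_nonneg_right (le_abs_self _) hδ.le)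
  have hsq : |C| * δ ^ 2 ≤ |C| * δ :=
    mul_le_mul_of_nonneg_left (by nlinarith) (abs_nonneg C)
  obtain ⟨hI1, hI2⟩ := abs_le.1 hI
  obtain ⟨hp1, hp2⟩ := abs_le.1 hsp
  obtain ⟨hm1, hm2⟩ := abs_le.1 hsm
  rw [hΨ.configurationalForce_eq hδ (by linarith) (by linarith),
    PhaseWave.configurationalForce_unperturbed (by linarith) (by linarith), abs_le]
  constructor <;> linarith
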